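/- Let $H_1,H_2$ be finite-dimensional complex Hilbert spaces with fixed orthonormal bases, so that operators on $H_1$ and on $H=H_1\otimes H_2$ are identified with complex matrices, and let $d_2=\dim H_2$. For a function $f\colon(0,\infty)\to\mathbf R$ and a positive definite matrix $A$ let $f(A)$ be given by the functional calculus. A function $f\colon(0,\infty)\to\mathbf R$ is called a matrix entropy (in the sense of Chen and Tropp) if it is either affine, or satisfies the following conditions: $f$ is convex and twice continuously differentiable, and for every $d\in\mathbf N$ and every positive definite complex $d\times d$ matrix $A$ the Fréchet differential $Df'(A)$ of the map $X\mapsto f'(X)$ at $A$ is an invertible linear operator on the real vector space $\mathbf H^d$ of Hermitian $d\times d$ matrices, and the map $A\mapsto [Df'(A)]^{-1}$ is concave on the positive definite $d\times d$ matrices with respect to the semidefinite order on operators on $\mathbf H^d$ (where $\mathbf H^d$ carries the inner product $\langle h,k\rangle=\operatorname{Tr} hk$). **Theorem.** Let $f\colon(0,\infty)\to\mathbf R$ be a matrix entropy. Then the function $$G(\rho)=d_2^{-1}\operatorname{Tr}_{12} f(d_2\rho)-\operatorname{Tr}_1 f(\rho_1)$$ is convex on the set of positive definite operators $\rho$ on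 $H=H_1\otimes H_2$, where $\rho_1=\operatorname{Tr}_2\rho$ is the partial trace of $\rho$ on $H_1$, and $\operatorname{Tr}_{12}$, $\operatorname{Tr}_1$ are the traces on $H$ and $H_1$. -/

import Mathlib

open scoped Matrix ComplexOrder

noncomputable section

namespace QuantumEntropy

/-- The real vector space of `n × n` complex Hermitian matrices, with the topology of entrywise
convergence (the topology of every norm). -/
abbrev Herm (n : Type*) := selfAdjoint (Matrix n n ℂ)

/-- The standard matrix function `A ↦ ψ(A)` on Hermitian matrices: `ψ` is applied to the
eigenvalues of `A`. -/
def matrixFunction {n : Type*} [Fintype n] [DecidableEq n] (ψ : ℝ → ℝ) (A : Herm n) : Herm n :=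
  ⟨cfc ψ (A : Matrix n n ℂ), cfc_predicate ψ (A : Matrix n n ℂ)⟩

/-- The cone of positive definite matrices, an open convex subset of the Hermitian matrices. -/
def posDefCone (n : Type*) [Fintype n] : Set (Herm n) :=
  {A | (A : Matrix n n ℂ).PosDef}

/-- The real trace inner product `⟨h, k⟩ = Tr (h k)` on Hermitian matrices. -/
def traceInner {n : Type*} [Fintype n] (h k : Herm n) : ℝ :=
  ((h : Matrix n n ℂ) * (k : Matrix n n ℂ)).trace.re

/-- The Fréchet differential `Dψ(A)` of the standard matrix function `ψ` at `A`, a real linear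
operator on the space of Hermitian matrices. -/
def matrixDeriv {n : Type*} [Fintype n] [DecidableEq n] (ψ : ℝ → ℝ) (A : Herm n) :
    Herm n →L[ℝ] Herm n :=
  fderiv ℝ (matrixFunction ψ) A

/-- Matrix entropies of Chen and Tropp (the class `Φ_∞`), for functions on `(0, ∞)`; only the
values of `f` on `(0, ∞)` matter. The function `f` is either affine, or it is convex and twice
continuously differentiable and, in every dimension `d`, the differential `Df'(A)` is an
invertible operator on the Hermitian matrices for every positive definite `A`, and
`A ↦ [Df'(A)]⁻¹` is concave with respect to the semidefinite order on operators on the Hermitian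
matrices (that is, all its quadratic forms with respect to the trace inner product are
concave). -/
def IsMatrixEntropy (f : ℝ → ℝ) : Prop :=
  (∃ a b : ℝ, ∀ t : ℝ, 0 < t → f t = a * t + b) ∨
  (ConvexOn ℝ (Set.Ioi 0) f ∧
    ContDiffOn ℝ 2 f (Set.Ioi 0) ∧
    ∀ d : ℕ,
      (∀ A ∈ posDefCone (Fin d), (matrixDeriv (deriv f) A).IsInvertible) ∧
      ∀ h : Herm (Fin d), ConcaveOn ℝ (posDefCone (Fin d))
        (fun A => traceInner h ((matrixDeriv (deriv f) A).inverse h)))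

/-- The partial trace over the second tensor factor, `ρ ↦ ρ₁ = Tr₂ ρ`. -/
def partialTrace₂ {m n : Type*} [Fintype n] (ρ : Matrix (m × n) (m × n) ℂ) : Matrix m m ℂ :=
  Matrix.of fun i j => ∑ k, ρ (i, k) (j, k)

/-- `Tr f(A)` for a Hermitian matrix `A` (a real number). -/
def traceFunction {n : Type*} [Fintype n] [DecidableEq n] (f : ℝ → ℝ) (A : Matrix n n ℂ) : ℝ :=
  (cfc f A).trace.re

/-- `G(ρ) = d₂⁻¹ Tr₁₂ f(d₂ ρ) - Tr₁ f(ρ₁)` with `d₂ = dim H₂`. -/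
def entropyGap {m n : Type*} [Fintype m] [DecidableEq m] [Fintype n] [DecidableEq n]
    (f : ℝ → ℝ) (ρ : Matrix (m × n) (m × n) ℂ) : ℝ :=
  (Fintype.card n : ℝ)⁻¹ * traceFunction f ((Fintype.card n : ℝ) • ρ)
    - traceFunction f (partialTrace₂ ρ)

end QuantumEntropy

end

/-!
Write `ψ = f'`, `d₂ = dim H₂`, and let `q(A, h) = ⟨h, Dψ(A) h⟩` be the Hessian form of the trace
function `A ↦ Tr f(A)`. Along a segment in direction `h` the second derivative of `G` is
`d₂⁻¹ q(d₂ ρ, d₂ h) - q(ρ₁, h₁)`, so convexity amounts to `d₂ q(ρ₁, h₁) ≤ q(d₂ ρ, d₂ h)`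
(`card_mul_traceInner_partialTrace_le`).

The calculus rests on Klein's inequality (`traceFunction_add_traceInner_le`), which says that the
trace function of a convex `f` lies above its affine approximations. It yields the gradient `ψ(A)`
of the trace function (`hasFDerivAt_traceFunction`) without any formula for derivatives of matrix
functions, and then the symmetry and the positivity of the Hessian `Dψ(A)`. That `ψ` is
differentiable as a matrix function is part of the hypothesis that `Dψ(A)` is invertible
(`differentiableAt_of_isInvertible_matrixDeriv`).

Since `Dψ(A)` is symmetric, positive and invertible,
`q(A, h) = max_k (2 ⟨h, k⟩ - ⟨k, Dψ(A)⁻¹ k⟩)`, and concavity of `A ↦ Dψ(A)⁻¹` makes `q` jointly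
convex (`convexOn_traceInner_matrixDeriv`). The average of `(1 ⊗ V) X (1 ⊗ V)*` over the signed
permutation matrices `V` of `H₂` is `Tr₂ X ⊗ 1 / d₂` (`sum_twirl`). As `q` is invariant under unitary
conjugation, and ampliation `A ↦ A ⊗ 1` multiplies it by `d₂` (`traceInner_matrixDeriv_hermMap`),
Jensen's inequality for this average is the required estimate.
-/

noncomputable section

namespace QuantumEntropy

open Filter Topology

open scoped Kronecker

/-! ### A norm on Hermitian matrices -/

section HermNorm

attribute [local instance] Matrix.normedAddCommGroup Matrix.normedSpace

/-- The entrywise supremum norm on Hermitian matrices. Its topology is definitionally the given one,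
so differentials with respect to this norm are the differentials in `Herm n`. -/
abbrev hermNormedAddCommGroup (n : Type*) [Fintype n] : NormedAddCommGroup (Herm n) :=
  letI b : NormedAddCommGroup (Herm n) := inferInstance
  { norm := b.norm
    toAddCommGroup := inferInstance
    toMetricSpace := b.toMetricSpace.replaceTopology (U := instTopologicalSpaceSubtype) rfl
    dist_eq := b.dist_eq }

/-- The real normed space structure that goes with `hermNormedAddCommGroup`. -/
abbrev hermNormedSpace (n : Type*) [Fintype n] :
    @NormedSpace ℝ (Herm n) _ (hermNormedAddCommGroup n).toSeminormedAddCommGroup :=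
  letI := hermNormedAddCommGroup n
  { toModule := inferInstance
    norm_smul_le := fun c A => norm_smul_le c (A : Matrix n n ℂ) }

end HermNorm

/-! ### Klein's inequality and differentials of trace functions -/

section Calculus

attribute [local instance] hermNormedAddCommGroup hermNormedSpace

variable {n : Type*} [Fintype n]

lemma finiteDimensional_herm : FiniteDimensional ℝ (Herm n) :=
  Module.Finite.of_injective (selfAdjoint.submodule ℝ (Matrix n n ℂ)).subtype
    Subtype.val_injective

lemma isOpen_posDefCone : IsOpen (posDefCone n) := by
  -- By homogeneity positivity need only be tested on the unit sphere, which is compact.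
  have key : posDefCone n = {A : Herm n | ∀ x ∈ Metric.sphere (0 : n → ℂ) 1,
      0 < (star x ⬝ᵥ ((A : Matrix n n ℂ) *ᵥ x)).re} := by
    ext A
    simp only [posDefCone, Set.mem_ofPred_eq]
    constructor
    · intro h x hx
      exact h.re_dotProduct_pos (by rintro rfl; simp at hx)
    · intro h
      refine .of_dotProduct_mulVec_pos A.2 fun x hx => ?_
      have him : (star x ⬝ᵥ ((A : Matrix n n ℂ) *ᵥ x)).im = 0 :=
        Matrix.IsHermitian.im_star_dotProduct_mulVec_self A.2 x
      have hx' : ‖x‖ ≠ 0 := norm_ne_zero_iff.2 hx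
      have h1 := h ((‖x‖⁻¹ : ℝ) • x) (by simp [norm_smul, hx'])
      rw [Matrix.mulVec_smul, star_smul, smul_dotProduct, dotProduct_smul] at h1
      simp only [star_trivial, Complex.smul_re, smul_eq_mul] at h1
      have h2 : 0 < (star x ⬝ᵥ ((A : Matrix n n ℂ) *ᵥ x)).re := by
        have : 0 < ‖x‖⁻¹ := by positivity
        exact pos_of_mul_pos_right (pos_of_mul_pos_right h1 this.le) this.le
      exact Complex.lt_def.2 ⟨h2, him.symm⟩
  rw [key, isOpen_iff_eventually]
  intro A hA
  refine (isCompact_sphere (0 : n → ℂ) 1).eventually_forall_of_forall_eventually fun x hx => ?_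
  have hc : Continuous fun p : Herm n × (n → ℂ) =>
      (star p.2 ⬝ᵥ ((p.1 : Matrix n n ℂ) *ᵥ p.2)).re := by
    fun_prop
  exact hc.continuousAt.eventually (lt_mem_nhds (hA x hx))

lemma traceInner_comm (h k : Herm n) : traceInner h k = traceInner k h := by
  rw [traceInner, Matrix.trace_mul_comm, traceInner]

variable (n) in
/-- The trace inner product as a continuous bilinear form. -/
def traceInnerL : Herm n →L[ℝ] Herm n →L[ℝ] ℝ :=
  haveI := finiteDimensional_herm (n := n)
  LinearMap.toContinuousLinearMap
    ((LinearMap.toContinuousLinearMap (𝕜 := ℝ) (E := Herm n) (F' := ℝ)).toLinearMap ∘ₗ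
      LinearMap.mk₂ ℝ traceInner
        (fun h h' k => by simp [traceInner, Matrix.add_mul])
        (fun c h k => by simp [traceInner])
        (fun h k k' => by simp [traceInner, Matrix.mul_add])
        (fun c h k => by simp [traceInner]))

@[simp]
lemma traceInnerL_apply (h k : Herm n) : traceInnerL n h k = traceInner h k := rfl

lemma hasDerivAt_line (A h : Herm n) (t : ℝ) : HasDerivAt (fun s : ℝ => A + s • h) h t := by
  simpa using ((hasDerivAt_id t).smul_const h).const_add A

variable [DecidableEq n]

lemma posDef_iff_spectrum_pos {A : Matrix n n ℂ} (hA : A.IsHermitian) :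
    A.PosDef ↔ ∀ x ∈ spectrum ℝ A, 0 < x := by
  rw [hA.posDef_iff_eigenvalues_pos, hA.spectrum_real_eq_range_eigenvalues]
  simp

lemma continuousOn_spectrum_real (ψ : ℝ → ℝ) (A : Matrix n n ℂ) :
    ContinuousOn ψ (spectrum ℝ A) :=
  A.finite_real_spectrum.continuousOn ψ

/-- Traces of products `φ(A) ψ(B)` are sums over pairs of eigenvalues, with nonnegative weights that
do not depend on `φ` and `ψ`: they are `|⟪u i, v j⟫|²` for the eigenbases `u` of `A` and `v` of
`B`. -/
lemma exists_trace_cfc_mul_cfc_eq_sum {A B : Matrix n n ℂ} (hA : A.IsHermitian)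
    (hB : B.IsHermitian) :
    ∃ w : n → n → ℝ, (∀ i j, 0 ≤ w i j) ∧ ∀ φ ψ : ℝ → ℝ,
      (cfc φ A * cfc ψ B).trace.re =
        ∑ i, ∑ j, w i j * (φ (hA.eigenvalues i) * ψ (hB.eigenvalues j)) := by
  let U : Matrix n n ℂ := hA.eigenvectorUnitary
  let V : Matrix n n ℂ := hB.eigenvectorUnitary
  refine ⟨fun i j => Complex.normSq ((Uᴴ * V) i j), fun i j => Complex.normSq_nonneg _,
    fun φ ψ => ?_⟩
  rw [hA.cfc_eq, hB.cfc_eq, Matrix.IsHermitian.cfc, Matrix.IsHermitian.cfc,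
    Unitary.conjStarAlgAut_apply, Unitary.conjStarAlgAut_apply]
  change (U * Matrix.diagonal _ * Uᴴ * (V * Matrix.diagonal _ * Vᴴ)).trace.re = _
  have : (U * Matrix.diagonal (RCLike.ofReal ∘ φ ∘ hA.eigenvalues) * Uᴴ *
      (V * Matrix.diagonal (RCLike.ofReal ∘ ψ ∘ hB.eigenvalues) * Vᴴ)).trace =
      (Matrix.diagonal (RCLike.ofReal ∘ φ ∘ hA.eigenvalues) * (Uᴴ * V) *
        (Matrix.diagonal (RCLike.ofReal ∘ ψ ∘ hB.eigenvalues) * (Uᴴ * V)ᴴ)).trace := by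
    simp only [Matrix.mul_assoc, Matrix.conjTranspose_mul, Matrix.conjTranspose_conjTranspose]
    rw [Matrix.trace_mul_comm]
    simp only [Matrix.mul_assoc]
  rw [this, Matrix.trace, Complex.re_sum]
  refine Finset.sum_congr rfl fun i _ => ?_
  rw [Matrix.diag_apply, Matrix.mul_apply, Complex.re_sum]
  refine Finset.sum_congr rfl fun j _ => ?_
  simp only [Matrix.diagonal_mul, Matrix.conjTranspose_apply, Function.comp_apply]
  generalize (Uᴴ * V) i j = z
  simp [Complex.normSq_apply]
  ring

/-- **Klein's inequality**: if `ψ` gives the slopes of supporting lines of `f` on `(0, ∞)`, then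
the trace function of `f` lies above its affine approximations with gradient `ψ(A)`. -/
lemma traceFunction_add_traceInner_le {f ψ : ℝ → ℝ}
    (hfψ : ∀ s t : ℝ, 0 < s → 0 < t → f s + ψ s * (t - s) ≤ f t)
    {A B : Herm n} (hA : A ∈ posDefCone n) (hB : B ∈ posDefCone n) :
    traceFunction f (A : Matrix n n ℂ) + traceInner (matrixFunction ψ A) (B - A) ≤
      traceFunction f (B : Matrix n n ℂ) := by
  have hA' : (A : Matrix n n ℂ).PosDef := hA
  have hB' : (B : Matrix n n ℂ).PosDef := hB
  obtain ⟨w, hw, h⟩ := exists_trace_cfc_mul_cfc_eq_sum hA'.isHermitian hB'.isHermitian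
  -- Each trace in the inequality becomes a sum with the same weights, so that the claim reduces to
  -- the scalar inequality at each pair of eigenvalues.
  have e1 := h f (fun _ => 1)
  have e2 := h ψ id
  have e3 := h (fun t => ψ t * t) (fun _ => 1)
  have e4 := h (fun _ => 1) f
  rw [cfc_const_one ℝ (A : Matrix n n ℂ), one_mul] at e4
  rw [cfc_const_one ℝ (B : Matrix n n ℂ), mul_one] at e1 e3
  rw [cfc_id ℝ (B : Matrix n n ℂ)] at e2
  rw [cfc_mul ψ (fun t => t) (A : Matrix n n ℂ) (continuousOn_spectrum_real _ _)
    (continuousOn_spectrum_real _ _), cfc_id' ℝ (A : Matrix n n ℂ)] at e3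
  simp only [traceFunction, traceInner, matrixFunction, AddSubgroup.coe_sub, Matrix.mul_sub,
    Matrix.trace_sub, Complex.sub_re]
  rw [e1, e2, e3, e4, ← Finset.sum_sub_distrib, ← Finset.sum_add_distrib]
  refine Finset.sum_le_sum fun i _ => ?_
  rw [← Finset.sum_sub_distrib, ← Finset.sum_add_distrib]
  refine Finset.sum_le_sum fun j _ => ?_
  have := mul_le_mul_of_nonneg_left
    (hfψ _ _ (hA'.eigenvalues_pos i) (hB'.eigenvalues_pos j)) (hw i j)
  simp only [id]
  linarith

/-- The gradient of a convex trace function, wherever `A ↦ ψ(A)` is continuous: by Klein's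
inequality the remainder is at most `⟨ψ(B) - ψ(A), B - A⟩`. -/
lemma hasFDerivAt_traceFunction {f ψ : ℝ → ℝ}
    (hfψ : ∀ s t : ℝ, 0 < s → 0 < t → f s + ψ s * (t - s) ≤ f t)
    {A : Herm n} (hA : A ∈ posDefCone n) (hψ : ContinuousAt (matrixFunction ψ) A) :
    HasFDerivAt (fun B : Herm n => traceFunction f (B : Matrix n n ℂ))
      (traceInnerL n (matrixFunction ψ A)) A := by
  rw [hasFDerivAt_iff_isLittleO, Asymptotics.isLittleO_iff]
  intro c hc
  have hcont : ContinuousAt (fun B => ‖traceInnerL n (matrixFunction ψ B - matrixFunction ψ A)‖)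
      A := by fun_prop
  have hsmall : ∀ᶠ B in 𝓝 A, ‖traceInnerL n (matrixFunction ψ B - matrixFunction ψ A)‖ < c :=
    hcont.eventually (gt_mem_nhds (by simpa using hc))
  filter_upwards [hsmall, isOpen_posDefCone.mem_nhds hA] with B hB hBp
  have h1 := traceFunction_add_traceInner_le hfψ hA hBp
  have h2 := traceFunction_add_traceInner_le hfψ hBp hA
  rw [← traceInnerL_apply] at h1 h2
  have h3 : traceInnerL n (matrixFunction ψ B - matrixFunction ψ A) (B - A) ≤ c * ‖B - A‖ :=
    (le_abs_self _).trans ((ContinuousLinearMap.le_opNorm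
      (traceInnerL n (matrixFunction ψ B - matrixFunction ψ A)) (B - A)).trans
        (mul_le_mul_of_nonneg_right hB.le (norm_nonneg _)))
  rw [map_sub (traceInnerL n), sub_apply] at h3
  rw [← neg_sub B A, map_neg] at h2
  rw [Real.norm_eq_abs, abs_le]
  constructor <;> nlinarith [norm_nonneg (B - A), mul_nonneg hc.le (norm_nonneg (B - A))]

variable {f ψ : ℝ → ℝ}

/-- The differential of `A ↦ ψ(A)` is the Hessian of a trace function, hence symmetric. -/
lemma traceInner_matrixDeriv_comm
    (hfψ : ∀ s t : ℝ, 0 < s → 0 < t → f s + ψ s * (t - s) ≤ f t)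
    (hd : ∀ A ∈ posDefCone n, DifferentiableAt ℝ (matrixFunction ψ) A)
    {A : Herm n} (hA : A ∈ posDefCone n) (h k : Herm n) :
    traceInner h (matrixDeriv ψ A k) = traceInner k (matrixDeriv ψ A h) := by
  have h1 : ∀ᶠ B in 𝓝 A, HasFDerivAt (fun B : Herm n => traceFunction f (B : Matrix n n ℂ))
      (traceInnerL n (matrixFunction ψ B)) B := by
    filter_upwards [isOpen_posDefCone.mem_nhds hA] with B hB
    exact hasFDerivAt_traceFunction hfψ hB (hd B hB).continuousAt
  have h2 : HasFDerivAt (fun B => traceInnerL n (matrixFunction ψ B))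
      (traceInnerL n ∘L matrixDeriv ψ A) A :=
    (traceInnerL n).hasFDerivAt.comp A (hd A hA).hasFDerivAt
  have := second_derivative_symmetric_of_eventually_of_real h1 h2 k h
  simp only [ContinuousLinearMap.comp_apply, traceInnerL_apply] at this
  rw [traceInner_comm h, traceInner_comm k, this]

lemma hasDerivAt_traceFunction_line
    (hfψ : ∀ s t : ℝ, 0 < s → 0 < t → f s + ψ s * (t - s) ≤ f t)
    (hd : ∀ A ∈ posDefCone n, DifferentiableAt ℝ (matrixFunction ψ) A)
    (A h : Herm n) {t : ℝ} (ht : A + t • h ∈ posDefCone n) :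
    HasDerivAt (fun s : ℝ => traceFunction f ((A + s • h : Herm n) : Matrix n n ℂ))
      (traceInner h (matrixFunction ψ (A + t • h))) t := by
  rw [traceInner_comm]
  exact (hasFDerivAt_traceFunction hfψ ht (hd _ ht).continuousAt).comp_hasDerivAt t
    (hasDerivAt_line A h t)

lemma hasDerivAt_traceInner_matrixFunction_line
    (hd : ∀ A ∈ posDefCone n, DifferentiableAt ℝ (matrixFunction ψ) A)
    (A h : Herm n) {t : ℝ} (ht : A + t • h ∈ posDefCone n) :
    HasDerivAt (fun s : ℝ => traceInner h (matrixFunction ψ (A + s • h)))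
      (traceInner h (matrixDeriv ψ (A + t • h) h)) t :=
  (traceInnerL n h).hasFDerivAt.comp_hasDerivAt t
    (HasFDerivAt.comp_hasDerivAt (l := matrixFunction ψ) t (hd _ ht).hasFDerivAt
      (hasDerivAt_line A h t))

lemma traceInner_matrixDeriv_nonneg
    (hfψ : ∀ s t : ℝ, 0 < s → 0 < t → f s + ψ s * (t - s) ≤ f t)
    (hd : ∀ A ∈ posDefCone n, DifferentiableAt ℝ (matrixFunction ψ) A)
    {A : Herm n} (hA : A ∈ posDefCone n) (h : Herm n) :
    0 ≤ traceInner h (matrixDeriv ψ A h) := by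
  have h0 : A + (0 : ℝ) • h ∈ posDefCone n := by simpa using hA
  have hder := hasDerivAt_traceInner_matrixFunction_line hd A h h0
  simp only [zero_smul, add_zero] at hder
  have hcone : ∀ᶠ t in 𝓝 (0 : ℝ), A + t • h ∈ posDefCone n :=
    (hasDerivAt_line A h 0).continuousAt.eventually (isOpen_posDefCone.mem_nhds h0)
  refine ge_of_tendsto hder.tendsto_slope_zero ?_
  filter_upwards [hcone.filter_mono nhdsWithin_le_nhds, self_mem_nhdsWithin] with t ht ht0
  have h1 := traceFunction_add_traceInner_le hfψ hA ht
  have h2 := traceFunction_add_traceInner_le hfψ ht hA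
  rw [← traceInnerL_apply, traceInnerL_apply, traceInner_comm, ← traceInnerL_apply] at h1 h2
  simp only [add_sub_cancel_left, sub_add_cancel_left, map_neg, map_smul,
    neg_apply, smul_apply, smul_eq_mul, traceInnerL_apply] at h1 h2
  have ht2 : 0 < t ^ 2 := by have : t ≠ 0 := ht0; positivity
  simp only [zero_add, zero_smul, add_zero, smul_eq_mul]
  have h3 : 0 ≤ t * (traceInner h (matrixFunction ψ (A + t • h)) -
      traceInner h (matrixFunction ψ A)) := by linarith
  -- Monotonicity of the gradient, `h3`, bounds the difference quotient for either sign of `t`.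
  have h4 : t⁻¹ = t / t ^ 2 := by field_simp
  rw [h4, div_mul_eq_mul_div]
  positivity

end Calculus

/-! ### Matrix functions and star homomorphisms -/

section StarHom

attribute [local instance] hermNormedAddCommGroup hermNormedSpace

variable {a b : Type*} [Fintype a] [DecidableEq a] [Fintype b] [DecidableEq b]

/-- The real linear map between Hermitian matrices given by a star homomorphism. -/
def hermMap (φ : Matrix a a ℂ →⋆ₐ[ℂ] Matrix b b ℂ) : Herm a →L[ℝ] Herm b where
  toFun A := ⟨φ A, A.2.map φ⟩
  map_add' A B := Subtype.ext (map_add φ _ _)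
  map_smul' c A := Subtype.ext (by
    change φ ((c : ℝ) • (A : Matrix a a ℂ)) = (c : ℝ) • φ (A : Matrix a a ℂ)
    rw [← Complex.coe_smul, map_smul, Complex.coe_smul])
  cont := ((LinearMap.continuous_of_finiteDimensional (φ : Matrix a a ℂ →ₗ[ℂ] Matrix b b ℂ)).comp
    continuous_subtype_val).subtype_mk _

lemma coe_hermMap (φ : Matrix a a ℂ →⋆ₐ[ℂ] Matrix b b ℂ) (A : Herm a) :
    (hermMap φ A : Matrix b b ℂ) = φ A := rfl

lemma matrixFunction_hermMap (ψ : ℝ → ℝ) (φ : Matrix a a ℂ →⋆ₐ[ℂ] Matrix b b ℂ) (A : Herm a) :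
    matrixFunction ψ (hermMap φ A) = hermMap φ (matrixFunction ψ A) :=
  Subtype.ext (StarAlgHom.map_cfc φ ψ (A : Matrix a a ℂ) (continuousOn_spectrum_real _ _)
    (LinearMap.continuous_of_finiteDimensional (φ : Matrix a a ℂ →ₗ[ℂ] Matrix b b ℂ))
    A.2 (A.2.map φ)).symm

lemma hermMap_mem_posDefCone (φ : Matrix a a ℂ →⋆ₐ[ℂ] Matrix b b ℂ) {A : Herm a}
    (hA : A ∈ posDefCone a) : hermMap φ A ∈ posDefCone b := by
  have hA' : (A : Matrix a a ℂ).PosDef := hA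
  refine (posDef_iff_spectrum_pos (hermMap φ A).2).2 fun x hx => ?_
  exact (posDef_iff_spectrum_pos A.2).1 hA' x
    (AlgHom.spectrum_apply_subset (φ.restrictScalars ℝ) (A : Matrix a a ℂ) hx)

lemma matrixDeriv_hermMap {ψ : ℝ → ℝ} (φ : Matrix a a ℂ →⋆ₐ[ℂ] Matrix b b ℂ) {A : Herm a}
    (hA : DifferentiableAt ℝ (matrixFunction ψ) A)
    (hφA : DifferentiableAt ℝ (matrixFunction ψ) (hermMap φ A)) (h : Herm a) :
    matrixDeriv ψ (hermMap φ A) (hermMap φ h) = hermMap φ (matrixDeriv ψ A h) := by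
  have h1 : HasFDerivAt (matrixFunction ψ ∘ hermMap φ) (matrixDeriv ψ (hermMap φ A) ∘L hermMap φ)
      A := hφA.hasFDerivAt.comp A (hermMap φ).hasFDerivAt
  have h2 : HasFDerivAt (hermMap φ ∘ matrixFunction ψ) (hermMap φ ∘L matrixDeriv ψ A) A :=
    (hermMap φ).hasFDerivAt.comp A hA.hasFDerivAt
  have h3 : matrixFunction ψ ∘ hermMap φ = hermMap φ ∘ matrixFunction ψ :=
    funext (matrixFunction_hermMap ψ φ)
  rw [h3] at h1
  exact congrArg (fun T : Herm a →L[ℝ] Herm b => T h) (h1.unique h2)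

lemma traceInner_hermMap {φ : Matrix a a ℂ →⋆ₐ[ℂ] Matrix b b ℂ} {c : ℝ}
    (hφ : ∀ X, (φ X).trace = c * X.trace) (h k : Herm a) :
    traceInner (hermMap φ h) (hermMap φ k) = c * traceInner h k := by
  rw [traceInner, coe_hermMap, coe_hermMap, ← map_mul, hφ, traceInner, Complex.re_ofReal_mul]

/-- The quadratic form of `Dψ` transforms under a star homomorphism as the trace does. -/
lemma traceInner_matrixDeriv_hermMap {ψ : ℝ → ℝ} {φ : Matrix a a ℂ →⋆ₐ[ℂ] Matrix b b ℂ} {c : ℝ}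
    (hφ : ∀ X, (φ X).trace = c * X.trace) {A : Herm a}
    (hA : DifferentiableAt ℝ (matrixFunction ψ) A)
    (hφA : DifferentiableAt ℝ (matrixFunction ψ) (hermMap φ A)) (h : Herm a) :
    traceInner (hermMap φ h) (matrixDeriv ψ (hermMap φ A) (hermMap φ h)) =
      c * traceInner h (matrixDeriv ψ A h) := by
  rw [matrixDeriv_hermMap φ hA hφA, traceInner_hermMap hφ]

/-- The star isomorphism `X ↦ (s i * s j * X (e i) (e j))`, which is relabelling by `e` followed by
conjugation with the diagonal sign matrix `s`. -/
def signedReindex (e : b ≃ a) (s : b → ℤˣ) : Matrix a a ℂ →⋆ₐ[ℂ] Matrix b b ℂ where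
  toFun X := Matrix.of fun i j => (((s i : ℤ) : ℂ) * ((s j : ℤ) : ℂ)) * X (e i) (e j)
  map_one' := by
    ext i j
    by_cases h : i = j
    · subst h
      rcases Int.units_eq_one_or (s i) with h | h <;> simp [h]
    · simp [h]
  map_mul' X Y := by
    ext i j
    simp only [Matrix.of_apply, Matrix.mul_apply, Finset.mul_sum]
    rw [← Equiv.sum_comp e]
    refine Finset.sum_congr rfl fun k _ => ?_
    rcases Int.units_eq_one_or (s k) with h | h <;> simp [h] <;> ring
  map_zero' := by ext; simp
  map_add' X Y := by ext; simp [mul_add]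
  commutes' c := by
    ext i j
    by_cases h : i = j
    · subst h
      rcases Int.units_eq_one_or (s i) with h | h <;> simp [h, Matrix.algebraMap_matrix_apply]
    · simp [h, Matrix.algebraMap_matrix_apply]
  map_star' X := by
    ext i j
    simp [Matrix.star_apply, mul_comm]

lemma signedReindex_apply (e : b ≃ a) (s : b → ℤˣ) (X : Matrix a a ℂ) (i j : b) :
    signedReindex e s X i j = (((s i : ℤ) : ℂ) * ((s j : ℤ) : ℂ)) * X (e i) (e j) := rfl

lemma trace_signedReindex (e : b ≃ a) (s : b → ℤˣ) (X : Matrix a a ℂ) :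
    (signedReindex e s X).trace = (1 : ℝ) * X.trace := by
  rw [Complex.ofReal_one, one_mul, Matrix.trace, Matrix.trace, ← Equiv.sum_comp e]
  refine Finset.sum_congr rfl fun i _ => ?_
  rw [Matrix.diag_apply, Matrix.diag_apply, signedReindex_apply]
  rcases Int.units_eq_one_or (s i) with h | h <;> simp [h]

lemma hermMap_signedReindex_symm (e : b ≃ a) (A : Herm b) :
    hermMap (signedReindex e 1) (hermMap (signedReindex e.symm 1) A) = A := by
  refine Subtype.ext (Matrix.ext fun i j => ?_)
  simp [coe_hermMap, signedReindex_apply]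

/-- The ampliation `X ↦ X ⊗ 1`. -/
def ampliation (m n : Type*) [Fintype m] [DecidableEq m] [Fintype n] [DecidableEq n] :
    Matrix m m ℂ →⋆ₐ[ℂ] Matrix (m × n) (m × n) ℂ where
  toFun X := X ⊗ₖ (1 : Matrix n n ℂ)
  map_one' := Matrix.one_kronecker_one
  map_mul' X Y := by rw [← Matrix.mul_kronecker_mul, one_mul]
  map_zero' := Matrix.zero_kronecker _
  map_add' X Y := Matrix.add_kronecker _ _ _
  commutes' c := by
    rw [Algebra.algebraMap_eq_smul_one, Algebra.algebraMap_eq_smul_one, Matrix.smul_kronecker,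
      Matrix.one_kronecker_one]
  map_star' X := by
    rw [Matrix.star_eq_conjTranspose, Matrix.star_eq_conjTranspose, Matrix.conjTranspose_kronecker,
      Matrix.conjTranspose_one]

lemma ampliation_apply {m n : Type*} [Fintype m] [DecidableEq m] [Fintype n] [DecidableEq n]
    (X : Matrix m m ℂ) : ampliation m n X = X ⊗ₖ (1 : Matrix n n ℂ) := rfl

lemma trace_ampliation {m n : Type*} [Fintype m] [DecidableEq m] [Fintype n] [DecidableEq n]
    (X : Matrix m m ℂ) :
    (ampliation m n X).trace = ((Fintype.card n : ℝ) : ℂ) * X.trace := by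
  rw [ampliation_apply, Matrix.trace_kronecker, Matrix.trace_one, mul_comm, Complex.ofReal_natCast]

end StarHom

/-! ### Joint convexity of the Hessian form -/

section JointConvexity

attribute [local instance] hermNormedAddCommGroup hermNormedSpace

variable {n : Type*} [Fintype n] [DecidableEq n] {f ψ : ℝ → ℝ}

omit [Fintype n] [DecidableEq n] in
lemma convex_setOf_posDef : Convex ℝ {A : Matrix n n ℂ | A.PosDef} :=
  convex_iff_forall_pos.2 fun _ hA _ hB _ _ hs ht _ =>
    Matrix.PosDef.add (Matrix.PosDef.smul hA hs) (Matrix.PosDef.smul hB ht)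

omit [DecidableEq n] in
lemma convex_posDefCone : Convex ℝ (posDefCone n) :=
  convex_setOf_posDef.linear_preimage (selfAdjoint.submodule ℝ (Matrix n n ℂ)).subtype

/-- One half of the variational formula
`⟨h, Dψ(A) h⟩ = max_k (2 ⟨h, k⟩ - ⟨k, Dψ(A)⁻¹ k⟩)`, with equality at `k = Dψ(A) h`. -/
lemma two_mul_traceInner_sub_le
    (hfψ : ∀ s t : ℝ, 0 < s → 0 < t → f s + ψ s * (t - s) ≤ f t)
    (hd : ∀ A ∈ posDefCone n, DifferentiableAt ℝ (matrixFunction ψ) A)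
    {A : Herm n} (hA : A ∈ posDefCone n) (hi : (matrixDeriv ψ A).IsInvertible) (h k : Herm n) :
    2 * traceInner h k - traceInner k ((matrixDeriv ψ A).inverse k) ≤
      traceInner h (matrixDeriv ψ A h) := by
  -- Positivity at `h - Dψ(A)⁻¹ k` is the claim, once the square is expanded.
  have h1 := traceInner_matrixDeriv_nonneg hfψ hd hA (h - (matrixDeriv ψ A).inverse k)
  have h2 := traceInner_matrixDeriv_comm hfψ hd hA ((matrixDeriv ψ A).inverse k) h
  rw [hi.self_apply_inverse] at h2
  rw [map_sub, hi.self_apply_inverse] at h1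
  simp only [← traceInnerL_apply, map_sub, sub_apply] at h1 h2 ⊢
  have h3 := traceInner_comm k ((matrixDeriv ψ A).inverse k)
  simp only [← traceInnerL_apply] at h3
  linarith

/-- Concavity of `A ↦ Dψ(A)⁻¹` makes `(A, h) ↦ ⟨h, Dψ(A) h⟩` jointly convex, because the variational
formula writes it as a supremum of jointly convex functions. -/
lemma convexOn_traceInner_matrixDeriv
    (hfψ : ∀ s t : ℝ, 0 < s → 0 < t → f s + ψ s * (t - s) ≤ f t)
    (hd : ∀ A ∈ posDefCone n, DifferentiableAt ℝ (matrixFunction ψ) A)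
    (hi : ∀ A ∈ posDefCone n, (matrixDeriv ψ A).IsInvertible)
    (hc : ∀ h : Herm n, ConcaveOn ℝ (posDefCone n)
      (fun A => traceInner h ((matrixDeriv ψ A).inverse h))) :
    ConvexOn ℝ (posDefCone n ×ˢ Set.univ)
      (fun p : Herm n × Herm n => traceInner p.2 (matrixDeriv ψ p.1 p.2)) := by
  refine ⟨convex_posDefCone.prod convex_univ, ?_⟩
  rintro ⟨A, h⟩ ⟨hA, -⟩ ⟨B, k⟩ ⟨hB, -⟩ s t hs ht hst
  simp only [Prod.smul_mk, Prod.mk_add_mk, smul_eq_mul] at hA hB ⊢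
  have hC := convex_posDefCone hA hB hs ht hst
  set C := s • A + t • B
  set l := s • h + t • k with hl
  -- `x` attains the maximum in the variational formula at `(C, l)`.
  set x := matrixDeriv ψ C l with hx
  have hinv : (matrixDeriv ψ C).inverse x = l := (hi C hC).inverse_apply_self l
  have h1 := (hc x).2 hA hB hs ht hst
  have h2 := mul_le_mul_of_nonneg_left
    (two_mul_traceInner_sub_le hfψ hd hA (hi A hA) h x) hs
  have h3 := mul_le_mul_of_nonneg_left
    (two_mul_traceInner_sub_le hfψ hd hB (hi B hB) k x) ht
  change s * _ + t * _ ≤ traceInner x ((matrixDeriv ψ C).inverse x) at h1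
  rw [hinv, traceInner_comm x l] at h1
  have h4 : traceInner l x = s * traceInner h x + t * traceInner k x := by
    simp [hl, ← traceInnerL_apply]
  linarith

/-- Differentiability of `ψ` as a matrix function depends only on the size of the matrices. -/
lemma differentiableAt_matrixFunction_of_equiv {d : Type*} [Fintype d] [DecidableEq d] (e : n ≃ d)
    (hd : ∀ A ∈ posDefCone d, DifferentiableAt ℝ (matrixFunction ψ) A)
    {A : Herm n} (hA : A ∈ posDefCone n) : DifferentiableAt ℝ (matrixFunction ψ) A := by
  have h : (matrixFunction ψ : Herm n → Herm n) = fun B =>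
      hermMap (signedReindex e 1) (matrixFunction ψ (hermMap (signedReindex e.symm 1) B)) := by
    funext B
    rw [← matrixFunction_hermMap, hermMap_signedReindex_symm]
  rw [h]
  exact (hermMap (signedReindex e 1)).differentiableAt.comp A
    (DifferentiableAt.comp (g := matrixFunction ψ) A (hd _ (hermMap_mem_posDefCone _ hA))
      (hermMap (signedReindex e.symm 1)).differentiableAt)

lemma convexOn_traceInner_matrixDeriv_of_equiv {d : Type*} [Fintype d] [DecidableEq d] (e : n ≃ d)
    (hd : ∀ A ∈ posDefCone d, DifferentiableAt ℝ (matrixFunction ψ) A)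
    (hc : ConvexOn ℝ (posDefCone d ×ˢ Set.univ)
      (fun p : Herm d × Herm d => traceInner p.2 (matrixDeriv ψ p.1 p.2))) :
    ConvexOn ℝ (posDefCone n ×ˢ Set.univ)
      (fun p : Herm n × Herm n => traceInner p.2 (matrixDeriv ψ p.1 p.2)) := by
  let L := hermMap (signedReindex e.symm 1)
  have h := (hc.comp_linearMap (L.prodMap L).toLinearMap).subset
    (s := posDefCone n ×ˢ Set.univ)
    (fun p hp => ⟨hermMap_mem_posDefCone _ hp.1, trivial⟩)
    (convex_posDefCone.prod convex_univ)
  refine h.congr ?_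
  rintro ⟨A, k⟩ ⟨hA, -⟩
  have := traceInner_matrixDeriv_hermMap (trace_signedReindex e.symm 1)
    (differentiableAt_matrixFunction_of_equiv e hd hA) (hd _ (hermMap_mem_posDefCone _ hA)) k
  rw [one_mul] at this
  exact this

end JointConvexity

/-! ### Averaging over signed permutations -/

section Averaging

variable {m n : Type*} [Fintype m] [DecidableEq m] [Fintype n] [DecidableEq n]

lemma sum_units_mul_eq_zero {k l : n} (hkl : k ≠ l) :
    ∑ s : n → ℤˣ, (((s k : ℤ) : ℂ) * ((s l : ℤ) : ℂ)) = 0 := by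
  -- Flipping the sign at `k` is a bijection that negates every term.
  have h := Equiv.sum_comp (Equiv.mulLeft (Pi.mulSingle k (-1) : n → ℤˣ))
    (fun s : n → ℤˣ => ((s k : ℤ) : ℂ) * ((s l : ℤ) : ℂ))
  simp only [Equiv.coe_mulLeft, Pi.mul_apply, Pi.mulSingle_eq_same,
    Pi.mulSingle_eq_of_ne hkl.symm, one_mul, Units.val_neg, neg_mul,
    Int.cast_neg, Finset.sum_neg_distrib] at h
  exact self_eq_neg.1 h.symm

lemma card_mul_sum_perm_apply (g : n → ℂ) (k : n) :
    (Fintype.card n : ℂ) * ∑ σ : Equiv.Perm n, g (σ k) =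
      (Fintype.card (Equiv.Perm n) : ℂ) * ∑ l, g l := by
  have h (l : n) : ∑ σ : Equiv.Perm n, g (σ k) = ∑ σ : Equiv.Perm n, g (σ l) := by
    rw [← Equiv.sum_comp (Equiv.mulRight (Equiv.swap k l))]
    simp
  calc (Fintype.card n : ℂ) * ∑ σ : Equiv.Perm n, g (σ k)
      = ∑ l : n, ∑ σ : Equiv.Perm n, g (σ l) := by
        rw [← Finset.sum_congr rfl fun l _ => h l]; simp
    _ = ∑ σ : Equiv.Perm n, ∑ l : n, g (σ l) := Finset.sum_comm
    _ = ∑ σ : Equiv.Perm n, ∑ l : n, g l :=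
        Finset.sum_congr rfl fun σ _ => Equiv.sum_comp σ g
    _ = _ := by simp

/-- Conjugation by `1 ⊗ V`, where `V` is the signed permutation matrix given by the signs `p.1` and
the permutation `p.2`. -/
def twirl (m : Type*) {n : Type*} [Fintype m] [DecidableEq m] [Fintype n] [DecidableEq n]
    (p : (n → ℤˣ) × Equiv.Perm n) :
    Matrix (m × n) (m × n) ℂ →⋆ₐ[ℂ] Matrix (m × n) (m × n) ℂ :=
  signedReindex (Equiv.prodCongr (Equiv.refl m) p.2) fun i => p.1 i.2

/-- Averaging over the signed permutations of the second factor replaces `X` by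
`Tr₂ X ⊗ 1 / dim H₂`: the signs remove the off-diagonal blocks and the permutations average the
diagonal ones. -/
lemma sum_twirl (X : Matrix (m × n) (m × n) ℂ) :
    (Fintype.card n : ℂ) • ∑ p : (n → ℤˣ) × Equiv.Perm n, twirl m p X =
      (Fintype.card ((n → ℤˣ) × Equiv.Perm n) : ℂ) • ampliation m n (partialTrace₂ X) := by
  ext ⟨i, k⟩ ⟨j, l⟩
  simp only [Matrix.smul_apply, Matrix.sum_apply, twirl, signedReindex_apply, smul_eq_mul,
    ampliation_apply, Matrix.kroneckerMap_apply, Fintype.sum_prod_type, partialTrace₂,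
    Matrix.of_apply, Equiv.prodCongr_apply, Prod.map, Equiv.refl_apply]
  rw [← Fintype.sum_mul_sum (fun s : n → ℤˣ => ((s k : ℤ) : ℂ) * ((s l : ℤ) : ℂ))
    (fun σ : Equiv.Perm n => X (i, σ k) (j, σ l))]
  by_cases hkl : k = l
  · subst hkl
    have h1 (s : n → ℤˣ) : ((s k : ℤ) : ℂ) * ((s k : ℤ) : ℂ) = 1 := by
      rcases Int.units_eq_one_or (s k) with h | h <;> simp [h]
    have h2 := card_mul_sum_perm_apply (fun l => X (i, l) (j, l)) k
    simp only [h1, Finset.sum_const, Finset.card_univ, nsmul_eq_mul, mul_one, Matrix.one_apply_eq,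
      Fintype.card_prod, Nat.cast_mul]
    rw [mul_left_comm, h2, mul_assoc]
  · rw [sum_units_mul_eq_zero hkl, Matrix.one_apply_ne hkl]
    simp

lemma trace_twirl (p : (n → ℤˣ) × Equiv.Perm n) (X : Matrix (m × n) (m × n) ℂ) :
    (twirl m p X).trace = (1 : ℝ) * X.trace :=
  trace_signedReindex _ _ X

end Averaging

/-! ### Convexity of the entropy gap -/

section Hessian

attribute [local instance] hermNormedAddCommGroup hermNormedSpace

variable {m n : Type*} [Fintype m] [DecidableEq m] [Fintype n] [DecidableEq n]

/-- The partial trace as a linear map between Hermitian matrices. -/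
def hermPartialTrace (m n : Type*) [Fintype n] : Herm (m × n) →ₗ[ℝ] Herm m where
  toFun ρ := ⟨partialTrace₂ (ρ : Matrix (m × n) (m × n) ℂ), by
    rw [selfAdjoint.mem_iff]
    ext i j
    simp only [partialTrace₂, Matrix.star_apply, Matrix.of_apply, star_sum]
    exact Finset.sum_congr rfl fun k _ => Matrix.IsHermitian.apply ρ.2 (i, k) (j, k)⟩
  map_add' A B := Subtype.ext (by
    ext i j
    simp [partialTrace₂, Finset.sum_add_distrib])
  map_smul' c A := Subtype.ext (by
    ext i j
    simp [partialTrace₂, Finset.mul_sum])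

omit [Fintype m] [DecidableEq m] [DecidableEq n] in
lemma posDef_partialTrace₂ [Nonempty n] {ρ : Matrix (m × n) (m × n) ℂ} (hρ : ρ.PosDef) :
    (partialTrace₂ ρ).PosDef := by
  have h : partialTrace₂ ρ = ∑ k : n, ρ.submatrix (fun i => (i, k)) (fun i => (i, k)) := by
    ext i j
    simp [partialTrace₂, Matrix.sum_apply]
  rw [h]
  exact Matrix.posDef_sum Finset.univ_nonempty fun k _ =>
    hρ.submatrix fun i j hij => congrArg Prod.fst hij

/-- The inequality `d₂ ⟨h₁, Dψ(ρ₁) h₁⟩ ≤ ⟨d₂ h, Dψ(d₂ ρ) (d₂ h)⟩`. Joint convexity is applied to the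
average of `(d₂ ρ, d₂ h)` over signed permutations, which is `(ρ₁ ⊗ 1, h₁ ⊗ 1)`; each term of the
average contributes the right-hand side. -/
lemma card_mul_traceInner_partialTrace_le [Nonempty n] {ψ : ℝ → ℝ}
    (hdm : ∀ A ∈ posDefCone m, DifferentiableAt ℝ (matrixFunction ψ) A)
    (hd : ∀ A ∈ posDefCone (m × n), DifferentiableAt ℝ (matrixFunction ψ) A)
    (hc : ConvexOn ℝ (posDefCone (m × n) ×ˢ Set.univ)
      (fun p : Herm (m × n) × Herm (m × n) => traceInner p.2 (matrixDeriv ψ p.1 p.2)))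
    {A : Herm (m × n)} (hA : A ∈ posDefCone (m × n)) (h : Herm (m × n)) :
    (Fintype.card n : ℝ) * traceInner (hermPartialTrace m n h)
        (matrixDeriv ψ (hermPartialTrace m n A) (hermPartialTrace m n h)) ≤
      traceInner ((Fintype.card n : ℝ) • h)
        (matrixDeriv ψ ((Fintype.card n : ℝ) • A) ((Fintype.card n : ℝ) • h)) := by
  set c : ℝ := (Fintype.card n : ℝ) with hcdef
  set N : ℕ := Fintype.card ((n → ℤˣ) × Equiv.Perm n) with hN
  have hN0 : (N : ℝ) ≠ 0 := Nat.cast_ne_zero.2 Fintype.card_ne_zero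
  have hNC : (N : ℂ) ≠ 0 := Nat.cast_ne_zero.2 Fintype.card_ne_zero
  have hcpos : 0 < c := Nat.cast_pos.2 Fintype.card_pos
  have hcA : c • A ∈ posDefCone (m × n) :=
    Matrix.PosDef.smul (x := (A : Matrix (m × n) (m × n) ℂ)) hA hcpos
  have hPA : hermPartialTrace m n A ∈ posDefCone m := posDef_partialTrace₂ hA
  have havg (X : Herm (m × n)) :
      ∑ p : (n → ℤˣ) × Equiv.Perm n, (N : ℝ)⁻¹ • hermMap (twirl m p) (c • X) =
        hermMap (ampliation m n) (hermPartialTrace m n X) := by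
    refine Subtype.ext ?_
    rw [← Finset.smul_sum]
    simp only [map_smul, ← Finset.smul_sum]
    have h1 := sum_twirl (X : Matrix (m × n) (m × n) ℂ)
    have h2 : (N : ℂ)⁻¹ • (Fintype.card n : ℂ) • ∑ p : (n → ℤˣ) × Equiv.Perm n, twirl m p X =
        ampliation m n (partialTrace₂ (X : Matrix (m × n) (m × n) ℂ)) := by
      rw [h1, smul_smul, inv_mul_cancel₀ hNC, one_smul]
    have h3 : ((∑ p : (n → ℤˣ) × Equiv.Perm n, hermMap (twirl m p) X : Herm (m × n)) :
        Matrix (m × n) (m × n) ℂ) = ∑ p : (n → ℤˣ) × Equiv.Perm n, twirl m p X := by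
      simp [coe_hermMap]
    rw [coe_hermMap]
    refine Eq.trans ?_ h2
    rw [← h3]
    ext i j
    simp [hcdef]
  have hJ := hc.map_sum_le (t := Finset.univ) (w := fun _ => (N : ℝ)⁻¹)
    (p := fun p : (n → ℤˣ) × Equiv.Perm n =>
      (hermMap (twirl m p) (c • A), hermMap (twirl m p) (c • h)))
    (fun _ _ => by positivity)
    (by simp [← hN, hN0])
    (fun p _ => ⟨hermMap_mem_posDefCone _ hcA, trivial⟩)
  have hinv (p : (n → ℤˣ) × Equiv.Perm n) :=
    traceInner_matrixDeriv_hermMap (trace_twirl p) (hd _ hcA)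
      (hd _ (hermMap_mem_posDefCone (twirl m p) hcA)) (c • h)
  simp only [hinv, one_mul, Prod.fst_sum, Prod.snd_sum, Prod.smul_fst, Prod.smul_snd, havg] at hJ
  rw [traceInner_matrixDeriv_hermMap trace_ampliation (hdm _ hPA)
    (hd _ (hermMap_mem_posDefCone _ hPA))] at hJ
  refine hJ.trans_eq ?_
  rw [Finset.sum_const, Finset.card_univ, ← hN, nsmul_eq_mul, smul_eq_mul,
    mul_inv_cancel_left₀ hN0]

/-- Convexity of the entropy gap from joint convexity of the quadratic form of `Dψ`, where `ψ` is
the derivative of `f`: the second derivative along segments is nonnegative. -/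
lemma convexOn_entropyGap_of_convexOn_traceInner [Nonempty n] {f ψ : ℝ → ℝ}
    (hfψ : ∀ s t : ℝ, 0 < s → 0 < t → f s + ψ s * (t - s) ≤ f t)
    (hdm : ∀ A ∈ posDefCone m, DifferentiableAt ℝ (matrixFunction ψ) A)
    (hd : ∀ A ∈ posDefCone (m × n), DifferentiableAt ℝ (matrixFunction ψ) A)
    (hc : ConvexOn ℝ (posDefCone (m × n) ×ˢ Set.univ)
      (fun p : Herm (m × n) × Herm (m × n) => traceInner p.2 (matrixDeriv ψ p.1 p.2))) :
    ConvexOn ℝ {ρ : Matrix (m × n) (m × n) ℂ | ρ.PosDef} (entropyGap f) := by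
  have hcpos : 0 < (Fintype.card n : ℝ) := Nat.cast_pos.2 Fintype.card_pos
  refine ⟨convex_setOf_posDef, fun A hA B hB s t hs ht hst => ?_⟩
  lift A to Herm (m × n) using hA.1
  lift B to Herm (m × n) using hB.1
  have hA' : A ∈ posDefCone (m × n) := hA
  have hB' : B ∈ posDefCone (m × n) := hB
  set c : ℝ := (Fintype.card n : ℝ) with hcdef
  set h := B - A with hh
  let P := hermPartialTrace m n
  have hline (x : ℝ) : A + x • h = (1 - x) • A + x • B := by rw [hh]; module
  have hmem (x : ℝ) (hx : x ∈ Set.Icc (0 : ℝ) 1) : A + x • h ∈ posDefCone (m × n) := by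
    rw [hline]
    exact convex_posDefCone hA' hB' (by linarith [hx.2]) hx.1 (by ring)
  have hcline (x : ℝ) : c • A + x • c • h = c • (A + x • h) := by module
  have hPline (x : ℝ) : P A + x • P h = P (A + x • h) := by rw [map_add, map_smul]
  have hcmem (x : ℝ) (hx : x ∈ Set.Icc (0 : ℝ) 1) : c • A + x • c • h ∈ posDefCone (m × n) := by
    rw [hcline]
    exact Matrix.PosDef.smul (x := ((A + x • h : Herm (m × n)) : Matrix (m × n) (m × n) ℂ))
      (hmem x hx) hcpos
  have hPmem (x : ℝ) (hx : x ∈ Set.Icc (0 : ℝ) 1) : P A + x • P h ∈ posDefCone m := by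
    rw [hPline]
    exact posDef_partialTrace₂ (hmem x hx)
  have hg1 (x : ℝ) (hx : x ∈ Set.Icc (0 : ℝ) 1) :=
    ((hasDerivAt_traceFunction_line hfψ hd (c • A) (c • h) (hcmem x hx)).const_mul c⁻¹).sub
      (hasDerivAt_traceFunction_line hfψ hdm (P A) (P h) (hPmem x hx))
  have hg2 (x : ℝ) (hx : x ∈ Set.Icc (0 : ℝ) 1) :=
    ((hasDerivAt_traceInner_matrixFunction_line hd (c • A) (c • h) (hcmem x hx)).const_mul
      c⁻¹).sub (hasDerivAt_traceInner_matrixFunction_line hdm (P A) (P h) (hPmem x hx))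
  have hconv := convexOn_of_hasDerivWithinAt2_nonneg (convex_Icc (0 : ℝ) 1)
    (fun x hx => (hg1 x hx).continuousAt.continuousWithinAt)
    (fun x hx => (hg1 x (interior_subset hx)).hasDerivWithinAt)
    (fun x hx => (hg2 x (interior_subset hx)).hasDerivWithinAt)
    (fun x hx => by
      have key := card_mul_traceInner_partialTrace_le hdm hd hc (hmem x (interior_subset hx)) h
      rw [hcline, hPline, sub_nonneg]
      rwa [inv_mul_eq_div, le_div_iff₀' hcpos])
  have hgap (x : ℝ) :
      c⁻¹ * traceFunction f ((c • A + x • c • h : Herm (m × n)) : Matrix (m × n) (m × n) ℂ) -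
        traceFunction f ((P A + x • P h : Herm m) : Matrix m m ℂ) =
      entropyGap f ((A + x • h : Herm (m × n)) : Matrix (m × n) (m × n) ℂ) := by
    rw [hcline, hPline]
    rfl
  have h01 := hconv.2 (Set.left_mem_Icc.2 zero_le_one) (Set.right_mem_Icc.2 zero_le_one) hs ht hst
  simp only [Pi.sub_apply, smul_eq_mul, mul_zero, mul_one, zero_add] at h01
  rw [hgap, hgap, hgap] at h01
  have e0 : A + (0 : ℝ) • h = A := by simp
  have e1 : A + (1 : ℝ) • h = B := by simp [hh]
  have et : A + t • h = s • A + t • B := by rw [hline, ← hst, add_sub_cancel_right]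
  rw [e0, e1, et] at h01
  exact h01

lemma traceFunction_of_affine {f : ℝ → ℝ} {a b : ℝ} (hf : ∀ t : ℝ, 0 < t → f t = a * t + b)
    {A : Matrix n n ℂ} (hA : A.PosDef) :
    traceFunction f A = a * A.trace.re + b * Fintype.card n := by
  have hsa : IsSelfAdjoint A := hA.1
  have h : cfc f A = cfc (fun t => a * t + b) A :=
    cfc_congr fun x hx => hf x ((posDef_iff_spectrum_pos hA.1).1 hA x hx)
  rw [traceFunction, h, cfc_add_const b (fun t => a * t) A (continuousOn_spectrum_real _ _),
    cfc_const_mul a (fun t => t) A (continuousOn_spectrum_real _ _), cfc_id' ℝ A,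
    Algebra.algebraMap_eq_smul_one]
  simp [Matrix.trace_add, Matrix.trace_smul, Matrix.trace_one]

omit [DecidableEq m] [DecidableEq n] in
lemma trace_partialTrace₂ (ρ : Matrix (m × n) (m × n) ℂ) : (partialTrace₂ ρ).trace = ρ.trace := by
  simp [Matrix.trace, partialTrace₂, Fintype.sum_prod_type]

lemma entropyGap_of_affine [Nonempty n] {f : ℝ → ℝ} {a b : ℝ}
    (hf : ∀ t : ℝ, 0 < t → f t = a * t + b) {ρ : Matrix (m × n) (m × n) ℂ} (hρ : ρ.PosDef) :
    entropyGap f ρ = 0 := by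
  have hcpos : 0 < (Fintype.card n : ℝ) := Nat.cast_pos.2 Fintype.card_pos
  rw [entropyGap, traceFunction_of_affine hf (hρ.smul hcpos),
    traceFunction_of_affine hf (posDef_partialTrace₂ hρ), trace_partialTrace₂, Matrix.trace_smul,
    Complex.smul_re, Fintype.card_prod]
  push_cast
  rw [smul_eq_mul]
  field_simp
  ring

/-- An invertible differential forces differentiability, since the differential is set to `0` at
points of non-differentiability and `0` is invertible only between trivial spaces. -/
lemma differentiableAt_of_isInvertible_matrixDeriv {ψ : ℝ → ℝ} {A : Herm n}
    (hA : (matrixDeriv ψ A).IsInvertible) : DifferentiableAt ℝ (matrixFunction ψ) A := by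
  by_contra h
  rw [matrixDeriv, fderiv_zero_of_not_differentiableAt h] at hA
  have := (ContinuousLinearMap.isInvertible_zero_iff.1 hA).1
  exact h (hasFDerivAt_of_subsingleton _ _).differentiableAt

end Hessian

end QuantumEntropy

end

open QuantumEntropy in
theorem mainTheorem1 {m n : Type*} [Fintype m] [DecidableEq m] [Fintype n] [DecidableEq n]
    (f : ℝ → ℝ) (hf : QuantumEntropy.IsMatrixEntropy f) :
    ConvexOn ℝ {ρ : Matrix (m × n) (m × n) ℂ | ρ.PosDef} (QuantumEntropy.entropyGap f) := by
  rcases isEmpty_or_nonempty n with hn | hn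
  · -- Here `dim H₂ = 0`, and the gap is a constant.
    refine (convexOn_const (-traceFunction f (0 : Matrix m m ℂ)) convex_setOf_posDef).congr
      fun ρ _ => ?_
    have h : partialTrace₂ ρ = 0 := by ext; simp [partialTrace₂]
    simp [entropyGap, h]
  rcases hf with ⟨a, b, hab⟩ | ⟨hcvx, hsmooth, hf⟩
  · exact (convexOn_const 0 convex_setOf_posDef).congr
      fun ρ hρ => (entropyGap_of_affine hab hρ).symm
  have hslope : ∀ s t : ℝ, 0 < s → 0 < t → f s + deriv f s * (t - s) ≤ f t := by
    intro s t hs ht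
    have hdiff : DifferentiableAt ℝ f s :=
      (hsmooth.contDiffAt (Ioi_mem_nhds hs)).differentiableAt two_ne_zero
    rcases lt_trichotomy s t with h | rfl | h
    · have := hcvx.deriv_le_slope hs ht h hdiff
      rw [slope_def_field, le_div_iff₀ (sub_pos.2 h)] at this
      linarith
    · simp
    · have := hcvx.slope_le_deriv ht hs h hdiff
      rw [slope_def_field, div_le_iff₀ (sub_pos.2 h)] at this
      linarith
  have hd (d : ℕ) : ∀ A ∈ posDefCone (Fin d), DifferentiableAt ℝ (matrixFunction (deriv f)) A :=
    fun A hA => differentiableAt_of_isInvertible_matrixDeriv ((hf d).1 A hA)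
  exact convexOn_entropyGap_of_convexOn_traceInner hslope
    (fun A => differentiableAt_matrixFunction_of_equiv (Fintype.equivFin m) (hd _))
    (fun A => differentiableAt_matrixFunction_of_equiv (Fintype.equivFin (m × n)) (hd _))
    (convexOn_traceInner_matrixDeriv_of_equiv (Fintype.equivFin (m × n)) (hd _)
      (convexOn_traceInner_matrixDeriv hslope (hd _) (hf _).1 (hf _).2))
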